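/- Let $P$ be a finite nonempty set of points in the Euclidean plane. For $p\in P$ let $C_0(p),\dots,C_3(p)$ be the four quadrants with apex $p$ bounded by the axis-parallel rays from $p$, in counter-clockwise order starting from the downward vertical ray. Assume that $P$ is in general position: no two points of $P$ lie on a line parallel to the boundary or to the angle bisector of one of these cones (that is, on a horizontal line, a vertical line, or a line of slope $\pm1$). The $\theta_4$-graph of $P$ has vertex set $P$; for every $p\in P$ and every $i$ for which $C_i(p)$ contains a point of $P\setminus\{p\}$, it has an edge between $p$ and the point of $(P\setminus\{p\})\cap C_i(p)$ whose orthogonal projection onto the angle bisector of $C_i(p)$ is closest to $p$. Edges are weighted by Euclidean length. For $t\ge 1$, a graph on $P$ is a $t$-spanner (of the complete Euclidean graph on $P$) if it is connected and, for all $u,v\in P$, its shortest path from $u$ to $v$ has length at most $t\,|uv|$; its stretch factor is the smallest such $t$. Then the $\theta_4$-graph of $P$ is a geometric spanner, namely a $t$-spanner for $$t=(1+\sqrt2)\,(\sqrt2+36)\,\sqrt{4+2\sqrt2}<237,$$ so its stretch factor is at most this constant. -/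

import Mathlib

open scoped NNReal ENNReal

/-! ## Weighted graphs, shortest paths and spanners -/

/-- The total weight of the edges of a walk. -/
def walkWeight {V : Type*} (w : V → V → ℝ≥0) {G : SimpleGraph V} {u v : V}
    (p : G.Walk u v) : ℝ≥0 :=
  (p.darts.map fun d => w d.fst d.snd).sum

/-- The weight of a shortest path from `u` to `v` in `G` (`∞` if there is no path). -/
noncomputable def shortestPathWeight {V : Type*} (w : V → V → ℝ≥0) (G : SimpleGraph V)
    (u v : V) : ℝ≥0∞ :=
  ⨅ p : G.Path u v, (walkWeight w (p : G.Walk u v) : ℝ≥0∞)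

/-- `H` is a `t`-spanner of the weighted graph `(G, w)`: a connected subgraph (on the same
vertices) in which shortest paths weigh at most `t` times as much as in `G`; here `1 ≤ t`. -/
structure IsSpanner {V : Type*} (w : V → V → ℝ≥0) (G H : SimpleGraph V) (t : ℝ) : Prop where
  one_le : 1 ≤ t
  le : H ≤ G
  connected : H.Connected
  weight_le : ∀ u v : V,
    shortestPathWeight w H u v ≤ ENNReal.ofReal t * shortestPathWeight w G u v

/-- `t` is the stretch factor of `H` in `(G, w)`: the smallest constant for which `H` is a
`t`-spanner. -/
def IsStretchFactor {V : Type*} (w : V → V → ℝ≥0) (G H : SimpleGraph V) (t : ℝ) : Prop :=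
  IsLeast {t : ℝ | IsSpanner w G H t} t

/-! ## The theta-graph with four cones -/

/-- The Euclidean plane. -/
abbrev Plane : Type := EuclideanSpace ℝ (Fin 2)

/-- The weight of an edge of a graph on a planar point set: the Euclidean distance. -/
noncomputable def euclideanWeight (P : Finset Plane) (u v : P) : ℝ≥0 :=
  nndist (u : Plane) (v : Plane)

/-- Directions of the four rays that bound the cones, in counter-clockwise order, starting
from the negative `y`-axis. -/
noncomputable def rayDir : Fin 4 → Plane :=
  ![!₂[0, -1], !₂[1, 0], !₂[0, 1], !₂[-1, 0]]

/-- The cone `C_i(p)` with apex `p` between the rays of directions `rayDir i` and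
`rayDir (i + 1)` (indices modulo 4). -/
def cone (i : Fin 4) (p : Plane) : Set Plane :=
  {q | ∃ a b : ℝ, 0 ≤ a ∧ 0 ≤ b ∧ q = p + (a • rayDir i + b • rayDir (i + 1))}

/-- The unit direction of the angle bisector of the cone `C_i(p)`. -/
noncomputable def bisectorDir (i : Fin 4) : Plane :=
  (√2)⁻¹ • (rayDir i + rayDir (i + 1))

/-- The orthogonal projection of `q` onto the angle bisector of `C_i(p)`. -/
noncomputable def bisectorProj (i : Fin 4) (p q : Plane) : Plane :=
  p + (inner ℝ (bisectorDir i) (q - p)) • bisectorDir i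

/-- `q` is the neighbour `p_i` of `p` in the cone `C_i(p)`: among the points of `P` in the cone
other than the apex, it is the one whose projection onto the bisector is closest to `p`. -/
def IsConeNeighbor (P : Finset Plane) (i : Fin 4) (p q : Plane) : Prop :=
  q ∈ P ∧ q ∈ cone i p ∧ q ≠ p ∧
    ∀ w ∈ P, w ∈ cone i p → w ≠ p → w ≠ q →
      dist p (bisectorProj i p q) < dist p (bisectorProj i p w)

/-- The theta-graph of `P` with four cones: `p` and `q` are joined if one of them is the
neighbour of the other in one of its cones. -/
def theta4Graph (P : Finset Plane) : SimpleGraph P :=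
  SimpleGraph.fromRel fun p q : P => ∃ i : Fin 4, IsConeNeighbor P i p q

/-- General position: no two points of `P` lie on a line parallel to the boundary or to the
angle bisector of a cone. -/
def GeneralPosition (P : Finset Plane) : Prop :=
  ∀ p ∈ P, ∀ q ∈ P, p ≠ q → ∀ i : Fin 4,
    q - p ∉ Submodule.span ℝ {rayDir i} ∧ q - p ∉ Submodule.span ℝ {bisectorDir i}

/-! ## Routing in an abstract quadrant system -/

/-! The argument gives the constant 55. Put the target `t` at the origin. Within a cone, projecting
onto the bisector orders points by L¹ distance from the apex, and Euclidean length is at most L¹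
length. So one can step to an L¹-closest vertex of any nonempty quadrant at L¹ cost
(`QuadrantStep`); with general position, this is all that the routing uses.

Greedy steps do not overshoot the line of slope ±1 through `t`, since `t` is itself a candidate, but
they may circle around `t` with little progress. Hence each greedy phase starts from a swept vertex
(`IsFrame.exists_swept`). By `IsFrame.round`, a round that does not reach `t` either returns to its
quadrant, paid for by a drop of `4 * cheb + A + B`, or ends in the opposite one. In the latter case,
emptiness of the regions searched halves the radius bounding the remaining vertices of one octant.
Four such radii, weighted by 12, pay for all these changes of quadrant (`IsFrame.reach_of_swept`).
-/

section Routing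

variable {V : Type*} {w : V → V → ℝ≥0} {G : SimpleGraph V}

/-- There is a walk from `p` to `q` of weight at most `ℓ`. -/
def Reach (w : V → V → ℝ≥0) (G : SimpleGraph V) (p q : V) (ℓ : ℝ) : Prop :=
  ∃ W : G.Walk p q, (walkWeight w W : ℝ) ≤ ℓ

theorem walkWeight_append {p q r : V} (W : G.Walk p q) (W' : G.Walk q r) :
    walkWeight w (W.append W') = walkWeight w W + walkWeight w W' := by
  simp [walkWeight, SimpleGraph.Walk.darts_append]

theorem Reach.refl (p : V) : Reach w G p p 0 := ⟨.nil, by simp [walkWeight]⟩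

theorem Reach.mono {p q : V} {a b : ℝ} (h : Reach w G p q a) (hab : a ≤ b) : Reach w G p q b :=
  let ⟨W, hW⟩ := h; ⟨W, hW.trans hab⟩

theorem Reach.trans {p q r : V} {a b : ℝ} (h : Reach w G p q a) (h' : Reach w G q r b) :
    Reach w G p r (a + b) := by
  obtain ⟨W, hW⟩ := h
  obtain ⟨W', hW'⟩ := h'
  refine ⟨W.append W', ?_⟩
  rw [walkWeight_append]
  push_cast
  exact add_le_add hW hW'

theorem Reach.of_adj {p q : V} (h : G.Adj p q) : Reach w G p q (w p q) :=
  ⟨h.toWalk, by simp [walkWeight, SimpleGraph.Adj.toWalk]⟩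

/-- Whenever the open quadrant of `p` in which both coordinates `A` and `B` increase contains a
vertex, one can go from `p` to an `L¹`-closest vertex of that quadrant, at `L¹` cost. -/
def QuadrantStep (w : V → V → ℝ≥0) (G : SimpleGraph V) (A B : V → ℝ) : Prop :=
  ∀ p q, A p < A q → B p < B q → ∃ n, A p < A n ∧ B p < B n ∧
    (∀ x, A p < A x → B p < B x → A n + B n ≤ A x + B x) ∧
    Reach w G p n (A n - A p + (B n - B p))

theorem QuadrantStep.swap {A B : V → ℝ} (h : QuadrantStep w G A B) : QuadrantStep w G B A := by
  intro p q h1 h2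
  obtain ⟨n, hn1, hn2, hn3, hn4⟩ := h p q h2 h1
  exact ⟨n, hn2, hn1, fun x hx hx' => by linarith [hn3 x hx' hx], hn4.mono (by linarith)⟩

/-- Coordinates centred at the target `t`, in general position, that admit quadrant steps in all
four directions. -/
structure IsFrame (w : V → V → ℝ≥0) (G : SimpleGraph V) (t : V) (A B : V → ℝ) : Prop where
  pos_pos : QuadrantStep w G A B
  neg_pos : QuadrantStep w G (-A) B
  pos_neg : QuadrantStep w G A (-B)
  neg_neg : QuadrantStep w G (-A) (-B)
  fst_target : A t = 0
  snd_target : B t = 0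
  fst_inj : Function.Injective A
  snd_inj : Function.Injective B
  ne : ∀ p, p ≠ t → A p ≠ B p
  ne_neg : ∀ p, p ≠ t → A p ≠ -B p

namespace IsFrame

variable {t : V} {A B : V → ℝ}

theorem swap (h : IsFrame w G t A B) : IsFrame w G t B A where
  pos_pos := h.pos_pos.swap
  neg_pos := h.pos_neg.swap
  pos_neg := h.neg_pos.swap
  neg_neg := h.neg_neg.swap
  fst_target := h.snd_target
  snd_target := h.fst_target
  fst_inj := h.snd_inj
  snd_inj := h.fst_inj
  ne p hp := (h.ne p hp).symm
  ne_neg p hp hB := h.ne_neg p hp (by linarith)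

theorem neg_fst (h : IsFrame w G t A B) : IsFrame w G t (-A) B where
  pos_pos := h.neg_pos
  neg_pos := by simpa using h.pos_pos
  pos_neg := h.neg_neg
  neg_neg := by simpa using h.pos_neg
  fst_target := by simp [h.fst_target]
  snd_target := h.snd_target
  fst_inj := neg_injective.comp h.fst_inj
  snd_inj := h.snd_inj
  ne p hp hB := h.ne_neg p hp (by rw [← hB]; simp)
  ne_neg p hp hB := h.ne p hp (by simpa using hB)

theorem neg_snd (h : IsFrame w G t A B) : IsFrame w G t A (-B) := h.swap.neg_fst.swap

theorem neg (h : IsFrame w G t A B) : IsFrame w G t (-A) (-B) := h.neg_fst.neg_snd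

theorem fst_ne_zero (h : IsFrame w G t A B) {p : V} (hp : p ≠ t) : A p ≠ 0 := fun h0 =>
  hp (h.fst_inj (h0.trans h.fst_target.symm))

theorem snd_ne_zero (h : IsFrame w G t A B) {p : V} (hp : p ≠ t) : B p ≠ 0 :=
  h.swap.fst_ne_zero hp

end IsFrame

/-! ### Chebyshev norm, octants and monotone walks -/

theorem wellFounded_lt_of_finite [Finite V] (f : V → ℝ) :
    WellFounded fun a b : V => f a < f b := by
  have : IsTrans V fun a b => f a < f b := ⟨fun _ _ _ => lt_trans⟩
  have : Std.Irrefl fun a b : V => f a < f b := ⟨fun _ => lt_irrefl _⟩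
  exact Finite.wellFounded_of_trans_of_irrefl _

/-- The Chebyshev norm of the coordinates of `x`. -/
noncomputable def cheb (A B : V → ℝ) (x : V) : ℝ := max |A x| |B x|

theorem cheb_swap (A B : V → ℝ) (x : V) : cheb B A x = cheb A B x := max_comm _ _

theorem cheb_neg (A B : V → ℝ) (x : V) : cheb (-A) (-B) x = cheb A B x := by simp [cheb]

theorem cheb_nonneg (A B : V → ℝ) (x : V) : 0 ≤ cheb A B x :=
  (abs_nonneg _).trans (le_max_left _ _)

theorem cheb_eq_fst {A B : V → ℝ} {x : V} (h0 : 0 < B x) (h : B x < A x) : cheb A B x = A x := by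
  rw [cheb, abs_of_pos h0, abs_of_pos (h0.trans h), max_eq_left h.le]

theorem cheb_eq_snd {A B : V → ℝ} {x : V} (h0 : 0 < A x) (h : A x < B x) : cheb A B x = B x := by
  rw [← cheb_swap, cheb_eq_fst h0 h]

theorem fst_le_cheb (A B : V → ℝ) (x : V) : A x ≤ cheb A B x :=
  (le_abs_self _).trans (le_max_left _ _)

theorem snd_le_cheb (A B : V → ℝ) (x : V) : B x ≤ cheb A B x :=
  (le_abs_self _).trans (le_max_right _ _)

/-- No vertex of either octant of the positive quadrant lies diagonally beyond `u`, on the side of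
`u` away from the bounding axis of the octant. -/
def Swept (A B : V → ℝ) (u : V) : Prop :=
  (∀ x, 0 < B x → B x < A x → A x < A u → B x ≤ B u) ∧
    ∀ x, 0 < A x → A x < B x → B x < B u → A x ≤ A u

theorem Swept.swap {A B : V → ℝ} {u : V} (h : Swept A B u) : Swept B A u := ⟨h.2, h.1⟩

variable {t : V} {A B : V → ℝ}

/-- Within the octant `0 < B < A` one can walk monotonically to a swept vertex. -/
theorem IsFrame.exists_swept [Finite V] (h : IsFrame w G t A B) (p : V) (h0 : 0 < B p)
    (h1 : B p < A p) : ∃ s, B p ≤ B s ∧ B s < A s ∧ A s ≤ A p ∧ Swept A B s ∧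
      Reach w G p s (A p - A s + (B s - B p)) := by
  induction p using (wellFounded_lt_of_finite A).induction with
  | _ p ih =>
    by_cases hx : ∃ x, B x < A x ∧ A x < A p ∧ B p < B x
    · obtain ⟨x, hx1, hx2, hx3⟩ := hx
      obtain ⟨n, hn1, hn2, hn3, hn4⟩ := h.neg_pos p x (by simpa using hx2) hx3
      -- Minimality against `x` gives `B n - A n ≤ B x - A x < 0`, so the step stays in the octant.
      have hn5 := hn3 x (by simpa using hx2) hx3
      simp only [Pi.neg_apply] at hn1 hn2 hn4 hn5
      obtain ⟨s, hs1, hs2, hs3, hs4, hs5⟩ := ih n (by linarith) (by linarith) (by linarith)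
      exact ⟨s, by linarith, hs2, by linarith, hs4, (hn4.trans hs5).mono (by linarith)⟩
    · push Not at hx
      exact ⟨p, le_rfl, h1, le_rfl, ⟨fun x _ hx1 hx2 => hx x hx1 hx2,
        fun x _ hx1 hx2 => by linarith⟩, (Reach.refl p).mono (by simp)⟩

/-- Greedy steps towards the target from a vertex of the quadrant `B < 0 < A`, until they leave
this quadrant. -/
theorem IsFrame.exists_exit [Finite V] (h : IsFrame w G t A B) (v : V) (hA : 0 < A v)
    (hB : B v < 0) : ∃ z, A z < A v ∧ B v < B z ∧
      (z = t ∨ (0 < B z ∧ B z < A z) ∨ (A z < 0 ∧ B z < A z)) ∧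
      Reach w G v z (A v - A z + (B z - B v)) := by
  induction v using (wellFounded_lt_of_finite A).induction with
  | _ v ih =>
    have ht1 : (-A) v < (-A) t := by simpa [h.fst_target] using hA
    have ht2 : B v < B t := by rwa [h.snd_target]
    obtain ⟨n, hn1, hn2, hn3, hn4⟩ := h.neg_pos v t ht1 ht2
    have hn5 := hn3 t ht1 ht2
    simp only [Pi.neg_apply, h.fst_target, h.snd_target] at hn1 hn2 hn4 hn5
    have hn6 : Reach w G v n (A v - A n + (B n - B v)) := hn4.mono (by linarith)
    rcases eq_or_ne n t with rfl | hnt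
    · exact ⟨n, by linarith, hn2, .inl rfl, hn6⟩
    have hlt : B n < A n := lt_of_le_of_ne (by linarith) (h.ne n hnt).symm
    rcases lt_or_gt_of_ne (h.snd_ne_zero hnt) with hb | hb
    · rcases lt_or_gt_of_ne (h.fst_ne_zero hnt) with ha | ha
      · exact ⟨n, by linarith, hn2, .inr (.inr ⟨ha, hlt⟩), hn6⟩
      · obtain ⟨z, hz1, hz2, hz3, hz4⟩ := ih n (by linarith) ha hb
        exact ⟨z, by linarith, by linarith, hz3, (hn6.trans hz4).mono (by linarith)⟩
    · exact ⟨n, by linarith, hn2, .inr (.inl ⟨hb, hlt⟩), hn6⟩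

/-! ### One routing round -/

/-- The outcome of one routing round from a swept vertex `u` of the positive quadrant: the target
is reached, or a swept vertex of the same quadrant at a cost covered by the potential
`4 * cheb + A + B`, or a swept vertex of the opposite quadrant, in which case the octant of `u`
contains no further vertices of Chebyshev norm between half that of `u` and the current one. -/
def RoundOutcome (w : V → V → ℝ≥0) (G : SimpleGraph V) (t : V) (A B : V → ℝ) (u : V) : Prop :=
  Reach w G u t (5 * cheb A B u) ∨
  (∃ u', 0 < A u' ∧ 0 < B u' ∧ Swept A B u' ∧ cheb A B u' < cheb A B u ∧
    Reach w G u u' (4 * cheb A B u + A u + B u - (4 * cheb A B u' + A u' + B u'))) ∨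
  ∃ z, A z < 0 ∧ B z < 0 ∧ Swept (-A) (-B) z ∧ cheb A B z < cheb A B u ∧
    Reach w G u z (5 * cheb A B u) ∧
    ∀ x, 0 < A x → 0 < B x → (A x < B x ↔ A u < B u) → cheb A B x ≤ cheb A B z →
      2 * cheb A B x ≤ cheb A B u

theorem IsFrame.ne_target_of_pos (h : IsFrame w G t A B) {x : V} (hx : 0 < A x) : x ≠ t := by
  rintro rfl
  exact hx.ne' h.fst_target

theorem IsFrame.lt_iff_not_lt (h : IsFrame w G t A B) {x : V} (hx : 0 < A x) :
    A x < B x ↔ ¬ B x < A x :=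
  ⟨fun h' => h'.not_gt, fun h' => lt_of_le_of_ne (not_lt.mp h') (h.ne x (h.ne_target_of_pos hx))⟩

theorem RoundOutcome.swap (h : IsFrame w G t A B) {u : V} (hu : 0 < A u)
    (ho : RoundOutcome w G t B A u) : RoundOutcome w G t A B u := by
  simp only [RoundOutcome, cheb_swap A B] at ho
  rcases ho with ho | ⟨u', h1, h2, h3, h4, h5⟩ | ⟨z, h1, h2, h3, h4, h5, h6⟩
  · exact .inl ho
  · exact .inr (.inl ⟨u', h2, h1, h3.swap, h4, h5.mono (by linarith)⟩)
  · refine .inr (.inr ⟨z, h2, h1, h3.swap, h4, h5, fun x hx hx' hiff => h6 x hx' hx ?_⟩)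
    rw [h.lt_iff_not_lt hx, h.lt_iff_not_lt hu] at hiff
    exact not_iff_not.mp hiff

/-- As `u` is swept, sweeping on from `n` cannot climb past `u`; the endpoint `s` was thus a
candidate for the greedy step, and `A s + B s ≤ A n + B n`. So the climb `B s - B n` is at most the
decrease of `A`, which the potential covers. -/
theorem IsFrame.round_inside [Finite V] (h : IsFrame w G t A B) {u n : V}
    (hsw : Swept A B u) (hA : A n < A u) (hn0 : 0 < B n)
    (hn1 : B n < A n) (hmin : ∀ x, A x < A u → B x < B u → A x + B x ≤ A n + B n)
    (hr : Reach w G u n (A u - A n + (B u - B n))) : RoundOutcome w G t A B u := by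
  obtain ⟨s, hs1, hs2, hs3, hs4, hs5⟩ := h.exists_swept n hn0 hn1
  have hsu : A s < A u := by linarith
  have hsu' : B s < B u := by
    refine lt_of_le_of_ne (hsw.1 s (by linarith) hs2 hsu) fun he => ?_
    rw [h.snd_inj he] at hsu
    exact lt_irrefl _ hsu
  have hm := hmin s hsu hsu'
  have hcs := cheb_eq_fst (A := A) (B := B) (x := s) (by linarith) hs2
  have hcu := fst_le_cheb A B u
  refine .inr (.inl ⟨s, by linarith, by linarith, hs4, by linarith, (hr.trans hs5).mono ?_⟩)
  linarith

/-- Here the greedy step passes the `A`-axis; the walk goes on around `t` until it exits the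
quadrant, and then sweeps again. -/
theorem IsFrame.round_cross [Finite V] (h : IsFrame w G t A B) {u n : V}
    (hsw : Swept A B u) (hA : A n < A u) (hn0 : B n < 0) (hn1 : 0 < A n + B n)
    (hmin : ∀ x, A x < A u → B x < B u → A x + B x ≤ A n + B n)
    (hr : Reach w G u n (A u - A n + (B u - B n))) : RoundOutcome w G t A B u := by
  have hcu := fst_le_cheb A B u
  have hcu' := snd_le_cheb A B u
  have hoct : ∀ x, 0 < B x → B x < A x → A x < A u → A x + B x ≤ A n + B n := by
    intro x hx hx' hxu
    refine hmin x hxu (lt_of_le_of_ne (hsw.1 x hx hx' hxu) fun he => ?_)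
    rw [h.snd_inj he] at hxu
    exact lt_irrefl _ hxu
  obtain ⟨z, hz1, hz2, hz3, hz4⟩ := h.exists_exit n (by linarith) hn0
  rcases hz3 with rfl | ⟨hz5, hz6⟩ | ⟨hz5, hz6⟩
  · refine .inl ((hr.trans hz4).mono ?_)
    rw [h.fst_target, h.snd_target]
    linarith
  · obtain ⟨s, hs1, hs2, hs3, hs4, hs5⟩ := h.exists_swept z hz5 hz6
    have hm := hoct s (by linarith) hs2 (by linarith)
    have hcs := cheb_eq_fst (A := A) (B := B) (x := s) (by linarith) hs2
    refine .inr (.inl ⟨s, by linarith, by linarith, hs4, by linarith,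
      ((hr.trans hz4).trans hs5).mono ?_⟩)
    linarith
  · obtain ⟨s, hs1, hs2, hs3, hs4, hs5⟩ := h.neg.swap.exists_swept z (by simpa using hz5)
      (by simpa using hz6)
    simp only [Pi.neg_apply] at hs1 hs2 hs3 hs5
    have hcs : cheb A B s = -B s := by
      rw [← cheb_neg, cheb_eq_snd] <;> simp only [Pi.neg_apply] <;> linarith
    refine .inr (.inr ⟨s, by linarith, by linarith, hs4.swap, by linarith,
      ((hr.trans hz4).trans hs5).mono (by linarith), fun x hx hx' hiff hxs => ?_⟩)
    have hcx := fst_le_cheb A B x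
    have hcx' := snd_le_cheb A B x
    by_cases hxo : A x < B x
    · have huo := hiff.mp hxo
      rw [cheb_eq_snd hx hxo] at hxs ⊢
      linarith [hmin x (by linarith) (by linarith)]
    · have hxo' : B x < A x := by
        by_contra hc
        exact hxo ((h.lt_iff_not_lt hx).mpr hc)
      rw [cheb_eq_fst hx' hxo'] at hxs ⊢
      -- Adding `A x ≤ A n + B n` and `A x ≤ -B s ≤ -B n` gives `2 * A x ≤ A n < A u`.
      linarith [hoct x hx' hxo' (by linarith)]

/-- One routing round from a swept vertex of the positive quadrant. -/
theorem IsFrame.round [Finite V] (h : IsFrame w G t A B) {u : V} (hu : 0 < A u) (hu' : 0 < B u)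
    (hsw : Swept A B u) : RoundOutcome w G t A B u := by
  obtain ⟨n, hn1, hn2, hn3, hn4⟩ := h.neg_neg u t (by simpa [h.fst_target] using hu)
    (by simpa [h.snd_target] using hu')
  simp only [Pi.neg_apply, neg_lt_neg_iff] at hn1 hn2 hn3 hn4
  have hmin : ∀ x, A x < A u → B x < B u → A x + B x ≤ A n + B n := fun x hx hx' => by
    linarith [hn3 x hx hx']
  have ht := hmin t (by rwa [h.fst_target]) (by rwa [h.snd_target])
  rw [h.fst_target, h.snd_target, add_zero] at ht
  have hr : Reach w G u n (A u - A n + (B u - B n)) := hn4.mono (by linarith)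
  have hr' : Reach w G u n (B u - B n + (A u - A n)) := hn4.mono (by linarith)
  have hmin' : ∀ x, B x < B u → A x < A u → B x + A x ≤ B n + A n := fun x hx hx' => by
    linarith [hmin x hx' hx]
  have hcu := fst_le_cheb A B u
  have hcu' := snd_le_cheb A B u
  rcases eq_or_ne n t with rfl | hnt
  · refine .inl (hr.mono ?_)
    rw [h.fst_target, h.snd_target]
    linarith
  have hpos : 0 < A n + B n := lt_of_le_of_ne ht fun h0 => h.ne_neg n hnt (by linarith)
  rcases lt_or_gt_of_ne (h.snd_ne_zero hnt) with hb | hb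
  · exact h.round_cross hsw hn1 hb hpos hmin hr
  rcases lt_or_gt_of_ne (h.fst_ne_zero hnt) with ha | ha
  · exact .swap h hu (h.swap.round_cross hsw.swap hn2 ha (by linarith) hmin' hr')
  rcases lt_or_gt_of_ne (h.ne n hnt) with hab | hab
  · exact .swap h hu (h.swap.round_inside hsw.swap hn2 ha hab hmin' hr')
  · exact h.round_inside hsw hn1 hb hab hmin hr

/-! ### Amortising the rounds -/

/-- `R₁, …, R₄` bound the Chebyshev norms, as far as these are at most `m`, of the vertices in the
four octants of the positive and the negative quadrant. -/
def OctantBounds (A B : V → ℝ) (m R₁ R₂ R₃ R₄ : ℝ) : Prop :=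
  ∀ x, cheb A B x ≤ m →
    (0 < B x → B x < A x → cheb A B x ≤ R₁) ∧ (0 < A x → A x < B x → cheb A B x ≤ R₂) ∧
    (B x < 0 → A x < B x → cheb A B x ≤ R₃) ∧ (A x < 0 → B x < A x → cheb A B x ≤ R₄)

theorem OctantBounds.mono {m m' R₁ R₂ R₃ R₄ : ℝ} (h : OctantBounds A B m R₁ R₂ R₃ R₄)
    (hm : m' ≤ m) : OctantBounds A B m' R₁ R₂ R₃ R₄ := fun x hx => h x (hx.trans hm)

theorem OctantBounds.neg {m R₁ R₂ R₃ R₄ : ℝ} (h : OctantBounds A B m R₁ R₂ R₃ R₄) :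
    OctantBounds (-A) (-B) m R₃ R₄ R₁ R₂ := by
  intro x hx
  rw [cheb_neg] at hx ⊢
  simp only [Pi.neg_apply, Left.neg_pos_iff, neg_lt_neg_iff, Left.neg_neg_iff]
  exact ⟨(h x hx).2.2.1, (h x hx).2.2.2, (h x hx).1, (h x hx).2.1⟩

theorem IsFrame.reach_of_swept [Finite V] (h : IsFrame w G t A B) (u : V) (hu : 0 < A u)
    (hu' : 0 < B u) (hsw : Swept A B u) {R₁ R₂ R₃ R₄ : ℝ} (h₁ : 0 ≤ R₁) (h₂ : 0 ≤ R₂) (h₃ : 0 ≤ R₃)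
    (h₄ : 0 ≤ R₄) (hR : OctantBounds A B (cheb A B u) R₁ R₂ R₃ R₄) :
    Reach w G u t (4 * cheb A B u + A u + B u + 12 * (R₁ + R₂ + R₃ + R₄)) := by
  -- The frame is negated during the induction; its Chebyshev norm is not, so `ρ` is a fixed
  -- measure.
  obtain ⟨ρ, hρ⟩ : ∃ ρ, ρ = cheb A B := ⟨_, rfl⟩
  induction u using (wellFounded_lt_of_finite ρ).induction generalizing A B R₁ R₂ R₃ R₄ with
  | _ u ih =>
    rcases h.round hu hu' hsw with h5 | ⟨u', k1, k2, k3, k4, k5⟩ | ⟨z, k1, k2, k3, k4, k5, k6⟩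
    · refine h5.mono ?_
      have : cheb A B u ≤ A u + B u := by
        rw [cheb, abs_of_pos hu, abs_of_pos hu']
        exact max_le (by linarith) (by linarith)
      linarith
    · refine (k5.trans (ih u' (by rwa [hρ]) h k1 k2 k3 h₁ h₂ h₃ h₄ (hR.mono k4.le) hρ)).mono ?_
      linarith
    · have hz := fst_le_cheb (-A) (-B) z
      have hz' := snd_le_cheb (-A) (-B) z
      have hu0 := cheb_nonneg A B u
      -- The round costs 5 and the potential at `z` is at most 6, in units of `cheb A B u`. The
      -- potential at `u` is at least 5, and replacing a radius of at least `cheb A B u` by half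
      -- that norm frees the other `12 / 2 = 6`.
      have key : ∀ S₁ S₂ : ℝ, 0 ≤ S₁ → 0 ≤ S₂ → OctantBounds A B (cheb A B z) S₁ S₂ R₃ R₄ →
          Reach w G u t (5 * cheb A B u + (6 * cheb A B u + 12 * (S₁ + S₂ + R₃ + R₄))) := by
        intro S₁ S₂ hS₁ hS₂ hS
        have hS' := hS.neg
        rw [← cheb_neg] at hS'
        refine k5.trans ((ih z (by rwa [hρ]) h.neg (by simpa using k1) (by simpa using k2) k3
          h₃ h₄ hS₁ hS₂ hS' (hρ.trans (funext fun x => (cheb_neg A B x).symm))).mono ?_)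
        rw [cheb_neg] at hz hz' ⊢
        linarith
      rcases lt_or_gt_of_ne (h.ne u (h.ne_target_of_pos hu)) with huo | huo
      · have hRu := (hR u le_rfl).2.1 hu huo
        have hcu := cheb_eq_snd hu huo
        refine (key R₁ (cheb A B u / 2) h₁ (by linarith) fun x hx => ?_).mono (by linarith)
        have hRx := hR x (hx.trans k4.le)
        refine ⟨hRx.1, fun hx1 hx2 => ?_, hRx.2.2⟩
        linarith [k6 x hx1 (hx1.trans hx2) (iff_of_true hx2 huo) hx]
      · have hRu := (hR u le_rfl).1 hu' huo
        have hcu := cheb_eq_fst hu' huo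
        refine (key (cheb A B u / 2) R₂ (by linarith) h₂ fun x hx => ?_).mono (by linarith)
        have hRx := hR x (hx.trans k4.le)
        refine ⟨fun hx1 hx2 => ?_, hRx.2⟩
        linarith [k6 x (hx1.trans hx2) hx1 (iff_of_false hx2.not_gt huo.not_gt) hx]

/-- With all four radii equal to `cheb A B s`, the bound from `s` is `4 + 2 + 12 * 4 = 54` times
this norm; the initial sweep adds at most one more unit. -/
theorem IsFrame.reach_of_octant [Finite V] (h : IsFrame w G t A B) {p : V} (h0 : 0 < B p)
    (h1 : B p < A p) : Reach w G p t (55 * cheb A B p) := by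
  obtain ⟨s, hs1, hs2, hs3, hs4, hs5⟩ := h.exists_swept p h0 h1
  have hcp := cheb_eq_fst h0 h1
  have hcs := cheb_eq_fst (h0.trans_le hs1) hs2
  have hc0 := cheb_nonneg A B s
  refine (hs5.trans (h.reach_of_swept s (by linarith) (by linarith) hs4 hc0 hc0 hc0 hc0
    fun x hx => ⟨fun _ _ => hx, fun _ _ => hx, fun _ _ => hx, fun _ _ => hx⟩)).mono ?_
  linarith

theorem IsFrame.reach_of_pos [Finite V] (h : IsFrame w G t A B) {p : V} (hA : 0 < A p)
    (hB : 0 < B p) : Reach w G p t (55 * cheb A B p) := by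
  rcases lt_or_gt_of_ne (h.ne p (h.ne_target_of_pos hA)) with hlt | hlt
  · rw [← cheb_swap]
    exact h.swap.reach_of_octant hA hlt
  · exact h.reach_of_octant hB hlt

/-- In a frame centred at `t`, every vertex is joined to `t` by a walk of weight at most `55` times
its Chebyshev distance from `t`. -/
theorem IsFrame.reach [Finite V] (h : IsFrame w G t A B) (p : V) :
    Reach w G p t (55 * cheb A B p) := by
  rcases eq_or_ne p t with rfl | hp
  · exact (Reach.refl p).mono (mul_nonneg (by norm_num) (cheb_nonneg A B p))
  have e1 : cheb (-A) B p = cheb A B p := by simp [cheb]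
  have e2 : cheb A (-B) p = cheb A B p := by simp [cheb]
  rcases lt_or_gt_of_ne (h.fst_ne_zero hp) with ha | ha <;>
    rcases lt_or_gt_of_ne (h.snd_ne_zero hp) with hb | hb
  · rw [← cheb_neg]
    exact h.neg.reach_of_pos (by simpa using ha) (by simpa using hb)
  · rw [← e1]
    exact h.neg_fst.reach_of_pos (by simpa using ha) hb
  · rw [← e2]
    exact h.neg_snd.reach_of_pos ha (by simpa using hb)
  · exact h.reach_of_pos ha hb

end Routing

/-! ## The theta-graph in coordinates -/

section Coordinates

/-- The sign of the horizontal coordinate in the cone `i`. -/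
def coneSignX : Fin 4 → ℝ := ![1, 1, -1, -1]

/-- The sign of the vertical coordinate in the cone `i`. -/
def coneSignY : Fin 4 → ℝ := ![-1, 1, 1, -1]

theorem mem_cone_iff (i : Fin 4) (p q : Plane) :
    q ∈ cone i p ↔ 0 ≤ coneSignX i * (q 0 - p 0) ∧ 0 ≤ coneSignY i * (q 1 - p 1) := by
  have key : ∀ a b : ℝ, q = p + (a • rayDir i + b • rayDir (i + 1)) ↔
      q 0 = p 0 + (a * rayDir i 0 + b * rayDir (i + 1) 0) ∧
      q 1 = p 1 + (a * rayDir i 1 + b * rayDir (i + 1) 1) := by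
    intro a b
    constructor
    · intro h
      rw [h]
      simp
    · rintro ⟨h0, h1⟩
      ext j
      fin_cases j
      · simpa using h0
      · simpa using h1
  simp only [cone, Set.mem_ofPred_eq, key]
  constructor
  · rintro ⟨a, b, ha, hb, h0, h1⟩
    rw [h0, h1]
    fin_cases i <;> simp [rayDir, coneSignX, coneSignY, ha, hb]
  · rintro ⟨h0, h1⟩
    fin_cases i <;> simp [rayDir, coneSignX, coneSignY] at h0 h1 ⊢
    · exact ⟨p 1 - q 1, by linarith, q 0 - p 0, by linarith, by ring, by ring⟩
    · exact ⟨q 0 - p 0, by linarith, q 1 - p 1, by linarith, by ring, by ring⟩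
    · exact ⟨q 1 - p 1, by linarith, p 0 - q 0, by linarith, by ring, by ring⟩
    · exact ⟨p 0 - q 0, by linarith, p 1 - q 1, by linarith, by ring, by ring⟩

theorem bisectorDir_apply (i : Fin 4) :
    bisectorDir i 0 = (√2)⁻¹ * coneSignX i ∧ bisectorDir i 1 = (√2)⁻¹ * coneSignY i := by
  fin_cases i <;> simp [bisectorDir, rayDir, coneSignX, coneSignY]

theorem norm_bisectorDir (i : Fin 4) : ‖bisectorDir i‖ = 1 := by
  have h2 : (√2)⁻¹ ^ 2 = (1 / 2 : ℝ) := by rw [inv_pow, Real.sq_sqrt (by norm_num)]; norm_num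
  rw [EuclideanSpace.norm_eq, Fin.sum_univ_two, (bisectorDir_apply i).1, (bisectorDir_apply i).2]
  simp only [Real.norm_eq_abs, sq_abs, mul_pow, h2]
  fin_cases i <;> norm_num [coneSignX, coneSignY]

theorem dist_bisectorProj {i : Fin 4} {p q : Plane} (h : q ∈ cone i p) :
    dist p (bisectorProj i p q) =
      (√2)⁻¹ * (coneSignX i * (q 0 - p 0) + coneSignY i * (q 1 - p 1)) := by
  have hin : inner ℝ (bisectorDir i) (q - p) =
      (√2)⁻¹ * (coneSignX i * (q 0 - p 0) + coneSignY i * (q 1 - p 1)) := by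
    rw [PiLp.inner_apply, Fin.sum_univ_two, (bisectorDir_apply i).1, (bisectorDir_apply i).2]
    simp
    ring
  rw [mem_cone_iff] at h
  rw [bisectorProj, dist_self_add_right, norm_smul, norm_bisectorDir, mul_one, hin,
    Real.norm_of_nonneg (mul_nonneg (by positivity) (add_nonneg h.1 h.2))]

theorem coneSign_cases (i : Fin 4) :
    (coneSignX i = 1 ∨ coneSignX i = -1) ∧ (coneSignY i = 1 ∨ coneSignY i = -1) := by
  fin_cases i <;> simp [coneSignX, coneSignY]

variable {P : Finset Plane}

theorem GeneralPosition.coord_ne (hgp : GeneralPosition P) {p q : Plane} (hp : p ∈ P) (hq : q ∈ P)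
    (hne : p ≠ q) : p 0 ≠ q 0 ∧ p 1 ≠ q 1 ∧ q 0 - p 0 ≠ q 1 - p 1 ∧ q 0 - p 0 ≠ -(q 1 - p 1) := by
  have key : ∀ v : Plane, ∀ c : ℝ, c * v 0 = q 0 - p 0 → c * v 1 = q 1 - p 1 →
      q - p ∈ Submodule.span ℝ {v} := by
    intro v c h0 h1
    refine Submodule.mem_span_singleton.mpr ⟨c, ?_⟩
    ext j
    fin_cases j
    · simpa using h0
    · simpa using h1
  have h2 : √2 * (√2)⁻¹ = (1 : ℝ) := mul_inv_cancel₀ (by positivity)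
  have bis : ∀ i c, c * coneSignX i = q 0 - p 0 → c * coneSignY i = q 1 - p 1 →
      q - p ∈ Submodule.span ℝ {bisectorDir i} := by
    intro i c h0 h1
    refine key _ (c * √2) ?_ ?_
    · rw [(bisectorDir_apply i).1, ← h0]
      linear_combination c * coneSignX i * h2
    · rw [(bisectorDir_apply i).2, ← h1]
      linear_combination c * coneSignY i * h2
  refine ⟨fun h => (hgp p hp q hq hne 2).1 ?_, fun h => (hgp p hp q hq hne 1).1 ?_,
    fun h => (hgp p hp q hq hne 1).2 ?_, fun h => (hgp p hp q hq hne 0).2 ?_⟩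
  · exact key _ (q 1 - p 1) (by simp [rayDir, h]) (by simp [rayDir])
  · exact key _ (q 0 - p 0) (by simp [rayDir]) (by simp [rayDir, h])
  · exact bis 1 (q 0 - p 0) (by simp [coneSignX]) (by simp [coneSignY, h])
  · exact bis 0 (q 0 - p 0) (by simp [coneSignX]) (by simp [coneSignY, h])

theorem exists_isConeNeighbor (hgp : GeneralPosition P) {i : Fin 4} {p q : Plane} (hq : q ∈ P)
    (hqc : q ∈ cone i p) (hqp : q ≠ p) : ∃ n, IsConeNeighbor P i p n := by
  classical
  obtain ⟨n, hn, hmin⟩ := (P.filter fun x => x ∈ cone i p ∧ x ≠ p).exists_min_image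
    (fun x => dist p (bisectorProj i p x)) ⟨q, Finset.mem_filter.mpr ⟨hq, hqc, hqp⟩⟩
  obtain ⟨hnP, hnc, hnp⟩ := Finset.mem_filter.mp hn
  refine ⟨n, hnP, hnc, hnp, fun x hx hxc hxp hxn => ?_⟩
  refine lt_of_le_of_ne (hmin x (Finset.mem_filter.mpr ⟨hx, hxc, hxp⟩)) fun he => ?_
  rw [dist_bisectorProj hnc, dist_bisectorProj hxc] at he
  -- A tie puts the two points on a line of slope ±1, which general position forbids.
  have he' := mul_left_cancel₀ (by positivity) he
  obtain ⟨-, -, h3, h4⟩ := hgp.coord_ne hnP hx hxn.symm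
  obtain ⟨hX | hX, hY | hY⟩ := coneSign_cases i <;> rw [hX, hY] at he'
  · exact h4 (by linarith)
  · exact h3 (by linarith)
  · exact h3 (by linarith)
  · exact h4 (by linarith)

theorem dist_le_coneSign {i : Fin 4} {p q : Plane} (h : q ∈ cone i p) :
    dist p q ≤ coneSignX i * (q 0 - p 0) + coneSignY i * (q 1 - p 1) := by
  obtain ⟨h0, h1⟩ := (mem_cone_iff i p q).mp h
  rw [EuclideanSpace.dist_eq, Fin.sum_univ_two, Real.sqrt_le_left (add_nonneg h0 h1)]
  simp only [Real.dist_eq, sq_abs]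
  have hX : coneSignX i ^ 2 = 1 := by rcases (coneSign_cases i).1 with h | h <;> simp [h]
  have hY : coneSignY i ^ 2 = 1 := by rcases (coneSign_cases i).2 with h | h <;> simp [h]
  nlinarith [mul_nonneg h0 h1, sq_nonneg (q 0 - p 0), sq_nonneg (q 1 - p 1)]

theorem quadrantStep_theta4Graph (hgp : GeneralPosition P) (t : Plane) (i : Fin 4)
    {A B : P → ℝ} (hA : ∀ p, A p = coneSignX i * ((p : Plane) 0 - t 0))
    (hB : ∀ p, B p = coneSignY i * ((p : Plane) 1 - t 1)) :
    QuadrantStep (euclideanWeight P) (theta4Graph P) A B := by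
  have hmem : ∀ p q : P, (q : Plane) ∈ cone i p ↔ A p ≤ A q ∧ B p ≤ B q := by
    intro p q
    rw [mem_cone_iff, hA, hA, hB, hB]
    constructor <;> rintro ⟨h0, h1⟩ <;> constructor <;> linarith
  have hproj : ∀ p q : P, (q : Plane) ∈ cone i p →
      dist (p : Plane) (bisectorProj i p q) = (√2)⁻¹ * (A q - A p + (B q - B p)) := by
    intro p q h
    rw [dist_bisectorProj h, hA, hA, hB, hB]
    ring
  intro p q h0 h1
  have hqp : q ≠ p := by rintro rfl; exact lt_irrefl _ h0
  obtain ⟨n, hnP, hnc, hnp, hmin⟩ := exists_isConeNeighbor hgp q.2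
    ((hmem p q).mpr ⟨h0.le, h1.le⟩) (fun h => hqp (Subtype.ext h))
  lift n to P using hnP
  obtain ⟨hle0, hle1⟩ := (hmem p n).mp hnc
  obtain ⟨g0, g1, -, -⟩ := hgp.coord_ne n.2 p.2 hnp
  have hX0 : coneSignX i ≠ 0 := by rcases (coneSign_cases i).1 with h | h <;> simp [h]
  have hY0 : coneSignY i ≠ 0 := by rcases (coneSign_cases i).2 with h | h <;> simp [h]
  refine ⟨n, lt_of_le_of_ne hle0 fun h => g0 ?_, lt_of_le_of_ne hle1 fun h => g1 ?_, ?_, ?_⟩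
  · rw [hA, hA] at h
    linarith [mul_left_cancel₀ hX0 h]
  · rw [hB, hB] at h
    linarith [mul_left_cancel₀ hY0 h]
  · intro x hx0 hx1
    rcases eq_or_ne x n with rfl | hxn
    · exact le_rfl
    have hxc := (hmem p x).mpr ⟨hx0.le, hx1.le⟩
    have hlt := hmin x x.2 hxc (fun h => hx0.ne (by rw [Subtype.ext h]))
      (fun h => hxn (Subtype.ext h))
    rw [hproj p n hnc, hproj p x hxc] at hlt
    linarith [lt_of_mul_lt_mul_left hlt (by positivity)]
  · have hadj : (theta4Graph P).Adj p n := by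
      rw [theta4Graph, SimpleGraph.fromRel_adj]
      exact ⟨fun h => hnp (by rw [h]), .inl ⟨i, n.2, hnc, hnp, hmin⟩⟩
    refine (Reach.of_adj hadj).mono ?_
    rw [euclideanWeight, coe_nndist]
    refine (dist_le_coneSign hnc).trans (le_of_eq ?_)
    rw [hA, hA, hB, hB]
    ring

theorem isFrame_theta4Graph (hgp : GeneralPosition P) (t : P) :
    IsFrame (euclideanWeight P) (theta4Graph P) t (fun p => (p : Plane) 0 - (t : Plane) 0)
      (fun p => (p : Plane) 1 - (t : Plane) 1) where
  pos_pos := quadrantStep_theta4Graph hgp t 1 (by simp [coneSignX]) (by simp [coneSignY])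
  neg_pos := quadrantStep_theta4Graph hgp t 2 (by simp [coneSignX]) (by simp [coneSignY])
  pos_neg := quadrantStep_theta4Graph hgp t 0 (by simp [coneSignX]) (by simp [coneSignY])
  neg_neg := quadrantStep_theta4Graph hgp t 3 (by simp [coneSignX]) (by simp [coneSignY])
  fst_target := sub_self _
  snd_target := sub_self _
  fst_inj p q h := by
    by_contra hne
    exact (hgp.coord_ne p.2 q.2 (fun h => hne (Subtype.ext h))).1 (by simpa using h)
  snd_inj p q h := by
    by_contra hne
    exact (hgp.coord_ne p.2 q.2 (fun h => hne (Subtype.ext h))).2.1 (by simpa using h)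
  ne p hp := (hgp.coord_ne t.2 p.2 (fun h => hp (Subtype.ext h.symm))).2.2.1
  ne_neg p hp := (hgp.coord_ne t.2 p.2 (fun h => hp (Subtype.ext h.symm))).2.2.2

/-- The `θ₄`-graph joins any two of its vertices by a walk of length at most `55` times their
Euclidean distance. -/
theorem reach_theta4Graph (hgp : GeneralPosition P) (u v : P) :
    Reach (euclideanWeight P) (theta4Graph P) u v (55 * dist (u : Plane) v) := by
  refine ((isFrame_theta4Graph hgp v).reach u).mono ?_
  have h : ∀ j, |(u : Plane) j - (v : Plane) j| ≤ dist (u : Plane) v := fun j => by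
    rw [dist_eq_norm]
    simpa using PiLp.norm_apply_le ((u : Plane) - (v : Plane)) j
  exact mul_le_mul_of_nonneg_left (max_le (h 0) (h 1)) (by norm_num)

end Coordinates

/-! ## Spanners and stretch factors -/

section Spanner

variable {V : Type*} {w : V → V → ℝ≥0} {G H : SimpleGraph V}

/-- Shortcutting a walk to a path only deletes darts, and weights are nonnegative. -/
theorem shortestPathWeight_le_of_reach {u v : V} {ℓ : ℝ} (h : Reach w G u v ℓ) :
    shortestPathWeight w G u v ≤ ENNReal.ofReal ℓ := by
  classical
  obtain ⟨W, hW⟩ := h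
  refine (iInf_le _ W.toPath).trans ?_
  have hle : walkWeight w (W.toPath : G.Walk u v) ≤ walkWeight w W := by
    refine List.Sublist.sum_le_sum (List.Sublist.map _ ?_) (fun _ _ => zero_le)
    exact W.darts_bypass_sublist_darts
  rw [← ENNReal.ofReal_coe_nnreal]
  exact ENNReal.ofReal_le_ofReal ((NNReal.coe_le_coe.mpr hle).trans hW)

theorem le_walkWeight (h0 : ∀ u, w u u = 0) (htri : ∀ u v x, w u x ≤ w u v + w v x) {u v : V}
    (W : G.Walk u v) : w u v ≤ walkWeight w W := by
  induction W with
  | nil => simp [h0]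
  | @cons u v x h W ih =>
    refine (htri u v x).trans ?_
    simpa [walkWeight] using ih

theorem le_shortestPathWeight (h0 : ∀ u, w u u = 0) (htri : ∀ u v x, w u x ≤ w u v + w v x)
    (u v : V) : (w u v : ℝ≥0∞) ≤ shortestPathWeight w G u v :=
  le_iInf fun p => by exact_mod_cast le_walkWeight h0 htri (p : G.Walk u v)

theorem shortestPathWeight_ne_top (hG : G.Connected) (u v : V) :
    shortestPathWeight w G u v ≠ ∞ := by
  obtain ⟨W⟩ := hG u v
  exact ne_top_of_le_ne_top ENNReal.ofReal_ne_top
    (shortestPathWeight_le_of_reach (w := w) ⟨W, le_rfl⟩)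

/-- A spanner of a connected graph has a stretch factor: the infimum of the admissible constants
is attained. -/
theorem IsSpanner.exists_isStretchFactor {s : ℝ} (hG : G.Connected) (h : IsSpanner w G H s) :
    ∃ τ, IsStretchFactor w G H τ ∧ τ ≤ s := by
  have hbdd : BddBelow {s : ℝ | IsSpanner w G H s} := ⟨1, fun _ hs => hs.one_le⟩
  have hset : {s : ℝ | IsSpanner w G H s} = {s : ℝ | 1 ≤ s} ∩ ⋂ u : V, ⋂ v : V,
      {s : ℝ | shortestPathWeight w H u v ≤ ENNReal.ofReal s * shortestPathWeight w G u v} := by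
    ext s
    simp only [Set.mem_ofPred_eq, Set.mem_inter_iff, Set.mem_iInter]
    exact ⟨fun hs => ⟨hs.one_le, hs.weight_le⟩, fun hs => ⟨hs.1, h.le, h.connected, hs.2⟩⟩
  -- Finite shortest path weights in `G` make the right-hand sides continuous in `s`.
  have hclosed : IsClosed {s : ℝ | IsSpanner w G H s} := by
    rw [hset]
    refine (isClosed_le continuous_const continuous_id).inter
      (isClosed_iInter fun u => isClosed_iInter fun v => isClosed_le continuous_const ?_)
    exact (ENNReal.continuous_mul_const (shortestPathWeight_ne_top hG u v)).comp
      ENNReal.continuous_ofReal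
  exact ⟨_, ⟨hclosed.csInf_mem ⟨s, h⟩ hbdd, fun _ hs => csInf_le hbdd hs⟩, csInf_le hbdd h⟩

theorem isSpanner_theta4Graph {P : Finset Plane} (hP : P.Nonempty) (hgp : GeneralPosition P)
    {s : ℝ} (hs : 55 ≤ s) : IsSpanner (euclideanWeight P) ⊤ (theta4Graph P) s where
  one_le := by linarith
  le := le_top
  connected :=
    { preconnected := fun u v => let ⟨W, _⟩ := reach_theta4Graph hgp u v; ⟨W⟩
      nonempty := hP.to_subtype }
  weight_le u v := by
    refine (shortestPathWeight_le_of_reach (reach_theta4Graph hgp u v)).trans ?_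
    rw [ENNReal.ofReal_mul (by norm_num)]
    refine mul_le_mul' (ENNReal.ofReal_le_ofReal hs) ?_
    refine le_trans (le_of_eq ?_) (le_shortestPathWeight (w := euclideanWeight P)
      (fun u => nndist_self _) (fun u v x => nndist_triangle _ _ _) u v)
    rw [euclideanWeight, ← coe_nndist, ENNReal.ofReal_coe_nnreal]

end Spanner

theorem sqrt_two_bounds : 1.414 < √2 ∧ √2 < 1.4143 :=
  ⟨Real.lt_sqrt_of_sq_lt (by norm_num), (Real.sqrt_lt' (by norm_num)).mpr (by norm_num)⟩

theorem mainTheorem1 (P : Finset Plane) (hP : P.Nonempty) (hgp : GeneralPosition P) :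
    IsSpanner (euclideanWeight P) ⊤ (theta4Graph P)
        ((1 + √2) * (√2 + 36) * √(4 + 2 * √2)) ∧
      (∃ τ : ℝ, IsStretchFactor (euclideanWeight P) ⊤ (theta4Graph P) τ ∧
        τ ≤ (1 + √2) * (√2 + 36) * √(4 + 2 * √2)) ∧
      (1 + √2) * (√2 + 36) * √(4 + 2 * √2) < 237 := by
  obtain ⟨hl, hu⟩ := sqrt_two_bounds
  have hl' : 2 < √(4 + 2 * √2) := Real.lt_sqrt_of_sq_lt (by linarith)
  have hu' : √(4 + 2 * √2) < 2.614 := (Real.sqrt_lt' (by norm_num)).mpr (by linarith)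
  have hprod : (1 + √2) * (√2 + 36) = 38 + 37 * √2 := by
    linear_combination Real.mul_self_sqrt (show (0 : ℝ) ≤ 2 by norm_num)
  have hsp : IsSpanner (euclideanWeight P) ⊤ (theta4Graph P)
      ((1 + √2) * (√2 + 36) * √(4 + 2 * √2)) := by
    refine isSpanner_theta4Graph hP hgp ?_
    rw [hprod]
    -- The constant exceeds `2 * (38 + 37 * √2)`, well above 55.
    nlinarith
  have : Nonempty P := hP.to_subtype
  refine ⟨hsp, hsp.exists_isStretchFactor SimpleGraph.connected_top, ?_⟩
  rw [hprod]
  nlinarith
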